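/- Let $d\ge 1$ and let $\Phi$ be a finite $\mathbb Z^d$-gain graph with vertex set $V=\{v_1,\dots,v_n\}$: multiple edges are allowed, and each link or loop $e$ has a gain $\phi(e)\in\mathbb Z^d$, which is negated when the orientation of $e$ is reversed. Half edges (with one endpoint and no gain) are also allowed. Assume that $\Phi$ has no balanced loops (loops of gain $0$) and no loose edges (edges without endpoints). Order $\mathbb Z^d$ componentwise; let $\vee,\wedge$ be componentwise max and min, and $\langle a\rangle^*=\{x\in\mathbb Z^d: x\ge a\}$. Let each vertex $v_i$ have a color list $\mathfrak h_i\subset\mathbb Z^d$ in the class $\mathfrak W_2$, i.e. of the form $\langle a\rangle^*\setminus A$ with $a\in\mathbb Z^d$ and $A\subset\langle a\rangle^*$ finite. Let $h_i=(h_{i1},\dots,h_{id})$ be the meet of the members of $\mathfrak h_i$, let $\bar H_i=\langle h_i\rangle^*\setminus\mathfrak h_i$, and let $\hat h_i=\bigvee\bar H_i$ if $\bar H_i\ne\emptyset$ and $\hat h_i=h_i-(1,\dots,1)$ otherwise. Let $\alpha_j(\Phi)$ be the join of the gains of all paths in $\Phi$ that begin at $v_j$ (the path of length $0$ included). For $m\in(\mathbb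 Z^d)^n$ let $\chi(m)=\chi(m_1,\dots,m_n)$ be the number of $x:V\to\mathbb Z^d$ with $x_i\in\mathfrak h_i$ and $x_i\le m_i$ for all $i$, and $x_j\ne x_i+\phi(e_{ij})$ for each link or loop $e_{ij}$. An edge set is balanced if it contains no half edge and every circle in it has gain $0$. A balanced set is closed if it contains every edge whose endpoints are joined by a path in the set with the same gain as the edge. Let $\mathcal L$ be the poset of closed balanced edge sets ordered by inclusion, with Möbius function $\mu$. For $B\in\mathcal L$ let $\pi(B)$ be the partition of $V$ into the vertex sets of the connected components of $(V,B)$, and let $\eta_B:V\to\mathbb Z^d$ be the unique function such that $\eta_B(v_i)=\phi(e_{ij})+\eta_B(v_j)$ for every edge $e_{ij}\in B$ and $\bigwedge_{v\in W}\eta_B(v)=0$ for every $W\in\pi(B)$. For $m'\in\mathbb Z^d$ define $$\bar q_k(B,W)=m'_k-\max_{v_i,v_j\in W}\bigl(h_{ik}+\eta_B(v_i)_k-\eta_B(v_j)_k\bigr)+1,$$ $$\bar p(m')=\sum_{B\in\mathcal L}\mu(\emptyset,B)\prod_{W\in\pi(B)}\Bigl(\prod_{k=1}^d\bar q_k(B,W)-\Bigl|\bigcup_{v_i\in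 W}\bigl(\bar H_i+\eta_B(v_i)\bigr)\cap\Bigl\langle\bigvee_{v_i\in W}\bigl(h_i+\eta_B(v_i)\bigr)\Bigr\rangle^*\Bigr|\Bigr).$$ Then $\bar p$ is a polynomial function of the $d$ variables $m'_1,\dots,m'_d$ (with integer coefficients), of degree at most $n$ in each variable and with leading term (top-degree homogeneous part) $\prod_{k=1}^d(m'_k)^n$. Moreover, for all $m'\in\mathbb Z^d$ with $m'\ge\hat h_j+\alpha_j(\Phi)$ for every $j$, i.e. $m'\ge\bigvee_{j=1}^n\bigl(\hat h_j+\alpha_j(\Phi)\bigr)$, the number $\chi(m',\dots,m')$ is finite and equals $\bar p(m')$. -/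

import Mathlib

/-- The kinds of edges of a gain graph: a link or loop `ordinary u v g`, which has gain `g` when
oriented from `u` to `v` (hence gain `-g` when oriented from `v` to `u`), a half edge with its
single endpoint, and a loose edge, which has no endpoints. -/
inductive EdgeKind (V G : Type*)
  | ordinary (u v : V) (g : G)
  | half (v : V)
  | loose

/-- A gain graph with vertex set `V`, edge set `E` (multiple edges allowed) and additively written
abelian gain group `G`. -/
structure GainGraph (V E G : Type*) where
  kind : E → EdgeKind V G

namespace GainGraph

/-- `Φ.Traverses e u v g`: the edge `e` can be oriented from `u` to `v`, and then has gain `g`. -/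
inductive Traverses {V E G : Type*} [AddCommGroup G] (Φ : GainGraph V E G) (e : E) :
    V → V → G → Prop
  | fwd {u v : V} {g : G} (h : Φ.kind e = EdgeKind.ordinary u v g) : Traverses Φ e u v g
  | bwd {u v : V} {g : G} (h : Φ.kind e = EdgeKind.ordinary u v g) : Traverses Φ e v u (-g)

/-- Walks in a gain graph. -/
inductive Walk {V E G : Type*} [AddCommGroup G] (Φ : GainGraph V E G) : V → V → Type _
  | nil (v : V) : Walk Φ v v
  | cons {u v w : V} (e : E) (g : G) (h : Φ.Traverses e u v g) (p : Walk Φ v w) : Walk Φ u w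

namespace Walk

/-- The gain of a walk: the sum of the gains of its edges, oriented along the walk. -/
def gain {V E G : Type*} [AddCommGroup G] {Φ : GainGraph V E G} :
    {u v : V} → Walk Φ u v → G
  | _, _, nil _ => 0
  | _, _, cons _ g _ p => g + p.gain

/-- The list of vertices of a walk, in order. -/
def support {V E G : Type*} [AddCommGroup G] {Φ : GainGraph V E G} :
    {u v : V} → Walk Φ u v → List V
  | _, _, nil v => [v]
  | u, _, cons _ _ _ p => u :: p.support

/-- The list of edges of a walk, in order. -/
def edges {V E G : Type*} [AddCommGroup G] {Φ : GainGraph V E G} :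
    {u v : V} → Walk Φ u v → List E
  | _, _, nil _ => []
  | _, _, cons e _ _ p => e :: p.edges

/-- A path does not repeat vertices; the path of length `0` is allowed. -/
def IsPath {V E G : Type*} [AddCommGroup G] {Φ : GainGraph V E G} {u v : V}
    (p : Walk Φ u v) : Prop :=
  p.support.Nodup

/-- A closed walk that goes once around a circle (a connected 2-regular subgraph): it has positive
length, its edges are distinct, and so are its vertices except that the first is also the last.
Loops and digons are circles. -/
def IsCircle {V E G : Type*} [AddCommGroup G] {Φ : GainGraph V E G} {v : V}
    (p : Walk Φ v v) : Prop :=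
  p.edges ≠ [] ∧ p.edges.Nodup ∧ p.support.tail.Nodup

/-- The walk uses only edges of `S`. -/
def InSet {V E G : Type*} [AddCommGroup G] {Φ : GainGraph V E G} {u v : V}
    (p : Walk Φ u v) (S : Finset E) : Prop :=
  ∀ e ∈ p.edges, e ∈ S

end Walk

/-- An edge set is balanced if it has no half edges and each of its circles has identity gain. -/
def Balanced {V E G : Type*} [AddCommGroup G] (Φ : GainGraph V E G) (S : Finset E) : Prop :=
  (∀ e ∈ S, ∀ v, Φ.kind e ≠ EdgeKind.half v) ∧
    ∀ (v : V) (p : Walk Φ v v), p.IsCircle → p.InSet S → p.gain = 0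

/-- An edge set is closed if it contains every edge whose endpoints are joined by a path in the set
with the same gain as the edge. (So balanced loops belong to every closed set; loose edges, which
are treated like balanced loops, also do.) It is used for balanced sets only. -/
def Closed {V E G : Type*} [AddCommGroup G] (Φ : GainGraph V E G) (S : Finset E) : Prop :=
  (∀ (e : E) (u v : V) (g : G), Φ.Traverses e u v g →
      (∃ p : Walk Φ u v, p.IsPath ∧ p.InSet S ∧ p.gain = g) → e ∈ S) ∧
    ∀ e : E, Φ.kind e = EdgeKind.loose → e ∈ S

/-- The semilattice of closed, balanced edge sets, ordered by inclusion. -/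
abbrev LatB {V E G : Type*} [AddCommGroup G] (Φ : GainGraph V E G) : Type _ :=
  {B : Finset E // Φ.Balanced B ∧ Φ.Closed B}

noncomputable instance {V E G : Type*} [AddCommGroup G] [Finite E] (Φ : GainGraph V E G) :
    Fintype Φ.LatB :=
  Fintype.ofFinite _

open Classical in
/-- The Möbius function value `μ(∅, B)` of the poset `LatB`, with the convention that it is `0` if
the empty set is not closed. -/
noncomputable def muEmpty {V E G : Type*} [AddCommGroup G] [Finite E] (Φ : GainGraph V E G)
    (B : Φ.LatB) : ℤ :=
  letI : LocallyFiniteOrder Φ.LatB := Fintype.toLocallyFiniteOrder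
  if h : Φ.Balanced ∅ ∧ Φ.Closed ∅ then IncidenceAlgebra.mu ℤ (⟨∅, h⟩ : Φ.LatB) B else 0

open Classical in
/-- The vertex set of the connected component of `v` in the spanning subgraph with edge set `S`. -/
noncomputable def component {V E G : Type*} [AddCommGroup G] [Fintype V] (Φ : GainGraph V E G)
    (S : Finset E) (v : V) : Finset V :=
  Finset.univ.filter fun w => ∃ p : Walk Φ v w, p.InSet S

open Classical in
/-- The partition `π(S)` of the vertex set into the vertex sets of the components of `S`. -/
noncomputable def parts {V E G : Type*} [AddCommGroup G] [Fintype V] (Φ : GainGraph V E G)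
    (S : Finset E) : Finset (Finset V) :=
  Finset.univ.image (Φ.component S)

/-- `η` is the top switching function for `S`: switching by `η` makes all gains in `S` zero, and the
meet of the values of `η` on each component of `S` is the identity of the gain group. -/
def IsTopSwitching {V E G : Type*} [AddCommGroup G] [Lattice G] [Fintype V]
    (Φ : GainGraph V E G) (S : Finset E) (η : V → G) : Prop :=
  (∀ e ∈ S, ∀ (u v : V) (g : G), Φ.Traverses e u v g → -η u + g + η v = 0) ∧
    ∀ W ∈ Φ.parts S, IsGLB (η '' (W : Set V)) 0

/-- The top switching function of `S` (which exists and is unique when `S` is balanced). -/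
noncomputable def topSwitching {V E G : Type*} [AddCommGroup G] [Lattice G] [Fintype V]
    (Φ : GainGraph V E G) (S : Finset E) : V → G :=
  Classical.epsilon fun η => Φ.IsTopSwitching S η

/-- `α_j(Φ)`: the least upper bound of the gains of all paths that begin at `v`. -/
noncomputable def pathGainSup {V E : Type*} {d : ℕ} (Φ : GainGraph V E (Fin d → ℤ)) (v : V) :
    Fin d → ℤ :=
  sSup {g | ∃ (w : V) (p : Walk Φ v w), p.IsPath ∧ p.gain = g}

end GainGraph

/-- Membership of a color list in the weight class `𝔚₂`: the list is a cone
`{x | a ≤ x}` with a finite set of points removed. -/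
def IsW2 {d : ℕ} (H : Set (Fin d → ℤ)) : Prop :=
  BddBelow H ∧ ∃ (a : Fin d → ℤ) (A : Set (Fin d → ℤ)), A.Finite ∧ A ⊆ Set.Ici a ∧ H = Set.Ici a \ A

/-- The meet of the members of the list `H`. -/
noncomputable def listBase {d : ℕ} (H : Set (Fin d → ℤ)) : Fin d → ℤ :=
  sInf H

/-- The points of the cone above `listBase H` that are missing from `H`. -/
def listGaps {d : ℕ} (H : Set (Fin d → ℤ)) : Set (Fin d → ℤ) :=
  Set.Ici (listBase H) \ H

open Classical in
/-- The join of `listGaps H`, or `listBase H - (1, …, 1)` if there are no gaps. -/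
noncomputable def listHat {d : ℕ} (H : Set (Fin d → ℤ)) : Fin d → ℤ :=
  if listGaps H = ∅ then listBase H - 1 else sSup (listGaps H)

namespace GainGraph

/-- The proper list colorations of `(Φ, H)` with upper bounds `m`. -/
def properColorations {V E : Type*} {d : ℕ} (Φ : GainGraph V E (Fin d → ℤ))
    (H : V → Set (Fin d → ℤ)) (m : V → Fin d → ℤ) : Set (V → Fin d → ℤ) :=
  {x | (∀ i, x i ∈ H i) ∧ x ≤ m ∧
    ∀ (e : E) (i j : V) (g : Fin d → ℤ), Φ.Traverses e i j g → x j ≠ x i + g}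

/-- The list chromatic function: the number of proper list colorations with upper bounds `m`. -/
noncomputable def chi {V E : Type*} {d : ℕ} (Φ : GainGraph V E (Fin d → ℤ))
    (H : V → Set (Fin d → ℤ)) (m : V → Fin d → ℤ) : ℕ :=
  (Φ.properColorations H m).ncard

/-- `q̄_k(B, W) = m'_k - max_{i, j ∈ W} (h_{ik} + η_B(i)_k - η_B(j)_k) + 1`. -/
noncomputable def qBar {V E : Type*} {d : ℕ} [Fintype V] (Φ : GainGraph V E (Fin d → ℤ))
    (H : V → Set (Fin d → ℤ)) (B : Finset E) (W : Finset V) (m' : Fin d → ℤ) (k : Fin d) : ℤ :=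
  m' k - sSup ((fun p : V × V =>
      listBase (H p.1) k + Φ.topSwitching B p.1 k - Φ.topSwitching B p.2 k) ''
    ((W : Set V) ×ˢ (W : Set V))) + 1

/-- The points of the contracted cone `{x | ∀ i ∈ W, h_i + η_B(i) ≤ x}` that lie in one of the
translated gap sets `H̄_i + η_B(i)`, `i ∈ W`. -/
noncomputable def gapsOn {V E : Type*} {d : ℕ} [Fintype V] (Φ : GainGraph V E (Fin d → ℤ))
    (H : V → Set (Fin d → ℤ)) (B : Finset E) (W : Finset V) : Set (Fin d → ℤ) :=
  (⋃ i ∈ W, (fun x => x + Φ.topSwitching B i) '' listGaps (H i)) ∩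
    {x | ∀ i ∈ W, listBase (H i) + Φ.topSwitching B i ≤ x}

/-- `p̄(m') = ∑_B μ(∅, B) ∏_{W ∈ π(B)} (∏_k q̄_k(B, W) - |gaps on W|)`. -/
noncomputable def pBar {V E : Type*} {d : ℕ} [Fintype V] [Finite E]
    (Φ : GainGraph V E (Fin d → ℤ)) (H : V → Set (Fin d → ℤ)) (m' : Fin d → ℤ) : ℤ :=
  ∑ B : Φ.LatB, Φ.muEmpty B *
    ∏ W ∈ Φ.parts B.1, ((∏ k, Φ.qBar H B.1 W m' k) - ((Φ.gapsOn H B.1 W).ncard : ℤ))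

end GainGraph

/-! For a coloration `x` from the lists, let `I(x)` be its set of improper edges. Along edges of
`I(x)` the color changes by the gain, so `I(x)` is balanced and closed, and `x` is proper iff `I(x)
= ∅`. Möbius inversion (`sum_muEmpty_subset`) writes the indicator of `I(x) = ∅` as the sum of `μ(∅,
B)` over `B ⊆ I(x)`. Exchanging sums leaves the count, for each `B`, of the colorations with `B ⊆
I(x)`.

These are the `x` for which `x + η_B` is constant on every part `W` of `π(B)`, so the count is a
product over parts (`ncard_listColorations_improper`). The constant value ranges over a box: its
lower corner is the join of the `h_i + η_B(i)`, and its upper corner is `m'` itself because `η_B`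
has meet `0` on `W`. The translated gaps are removed. Since `η_B ≤ α`
(`topSwitching_le_pathGainSup`), the hypothesis on `m'` puts all these gaps inside the box and makes
its side lengths nonnegative, so the factor is the one in `p̄`.

The term of `B` has degree at most `d` times the number of parts. Only `B = ∅` has `n` parts, so it
alone gives the leading form. -/

namespace GainGraph

/-! ### Walks, paths and gains in balanced sets. -/

section Walks

variable {V E G : Type*} [AddCommGroup G] {Φ : GainGraph V E G}

theorem Traverses.symm {e : E} {u v : V} {g : G} (h : Φ.Traverses e u v g) :
    Φ.Traverses e v u (-g) := by
  cases h with
  | fwd h => exact .bwd h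
  | bwd h => rw [neg_neg]; exact .fwd h

theorem Traverses.eq_or_eq {e : E} {u v u' v' : V} {g g' : G} (h : Φ.Traverses e u v g)
    (h' : Φ.Traverses e u' v' g') :
    (u' = u ∧ v' = v ∧ g' = g) ∨ (u' = v ∧ v' = u ∧ g' = -g) := by
  cases h with
  | fwd h =>
    cases h' with
    | fwd h' =>
      rw [h] at h'; injection h' with h1 h2 h3
      exact .inl ⟨h1.symm, h2.symm, h3.symm⟩
    | bwd h' =>
      rw [h] at h'; injection h' with h1 h2 h3
      exact .inr ⟨h2.symm, h1.symm, by rw [h3]⟩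
  | bwd h =>
    cases h' with
    | fwd h' =>
      rw [h] at h'; injection h' with h1 h2 h3
      exact .inr ⟨h1.symm, h2.symm, by rw [neg_neg, h3]⟩
    | bwd h' =>
      rw [h] at h'; injection h' with h1 h2 h3
      exact .inl ⟨h2.symm, h1.symm, by rw [h3]⟩

namespace Walk

/-- Concatenation of walks. -/
def append : {u v w : V} → Walk Φ u v → Walk Φ v w → Walk Φ u w
  | _, _, _, nil _, q => q
  | _, _, _, cons e g h p, q => cons e g h (p.append q)

@[simp] theorem gain_append {u v w : V} (p : Walk Φ u v) (q : Walk Φ v w) :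
    (p.append q).gain = p.gain + q.gain := by
  induction p with
  | nil => simp [append, gain]
  | cons e g h p ih => simp [append, gain, ih, add_assoc]

@[simp] theorem edges_append {u v w : V} (p : Walk Φ u v) (q : Walk Φ v w) :
    (p.append q).edges = p.edges ++ q.edges := by
  induction p with
  | nil => simp [append, edges]
  | cons e g h p ih => simp [append, edges, ih]

/-- The reverse of a walk. -/
def reverse : {u v : V} → Walk Φ u v → Walk Φ v u
  | _, _, nil v => nil v
  | _, _, cons e g h p => p.reverse.append (cons e (-g) h.symm (nil _))

@[simp] theorem gain_reverse {u v : V} (p : Walk Φ u v) : p.reverse.gain = -p.gain := by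
  induction p with
  | nil => simp [reverse, gain]
  | cons e g h p ih => simp [reverse, gain, ih, add_comm]

@[simp] theorem mem_edges_reverse {u v : V} (p : Walk Φ u v) (e : E) :
    e ∈ p.reverse.edges ↔ e ∈ p.edges := by
  induction p with
  | nil => simp [reverse, edges]
  | cons e g h p ih => simp [reverse, edges, ih, or_comm]

theorem InSet.append {S : Finset E} {u v w : V} {p : Walk Φ u v} {q : Walk Φ v w}
    (hp : p.InSet S) (hq : q.InSet S) : (p.append q).InSet S := by
  intro e he
  rw [edges_append, List.mem_append] at he
  exact he.elim (hp e) (hq e)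

theorem InSet.reverse {S : Finset E} {u v : V} {p : Walk Φ u v} (hp : p.InSet S) :
    p.reverse.InSet S :=
  fun e he => hp e ((mem_edges_reverse p e).1 he)

theorem inSet_nil (S : Finset E) (v : V) : (nil v : Walk Φ v v).InSet S := by
  intro e he
  simp [edges] at he

theorem inSet_cons {S : Finset E} {u v w : V} {e : E} {g : G} {h : Φ.Traverses e u v g}
    {p : Walk Φ v w} : (cons e g h p).InSet S ↔ e ∈ S ∧ p.InSet S := by
  simp [InSet, edges]

theorem start_mem_support {u v : V} (p : Walk Φ u v) : u ∈ p.support := by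
  cases p <;> simp [support]

theorem end_mem_support {u v : V} (p : Walk Φ u v) : v ∈ p.support := by
  induction p with
  | nil => simp [support]
  | cons e g h p ih => simp [support, ih]

theorem mem_support_of_mem_edges {u v : V} (p : Walk Φ u v) {e : E} (he : e ∈ p.edges)
    {a b : V} {g : G} (h : Φ.Traverses e a b g) : a ∈ p.support := by
  induction p with
  | nil => simp [edges] at he
  | cons e' g' h' p ih =>
    rw [edges, List.mem_cons] at he
    rcases he with rfl | he
    · rcases h'.eq_or_eq h with ⟨rfl, -, -⟩ | ⟨rfl, -, -⟩
      · simp [support]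
      · simp [support, start_mem_support]
    · exact List.mem_cons_of_mem _ (ih he)

theorem IsPath.of_cons {u v w : V} {e : E} {g : G} {h : Φ.Traverses e u v g} {p : Walk Φ v w}
    (hp : (cons e g h p).IsPath) : u ∉ p.support ∧ p.IsPath :=
  List.nodup_cons.1 hp

theorem IsPath.edges_nodup {u v : V} {p : Walk Φ u v} (hp : p.IsPath) : p.edges.Nodup := by
  induction p with
  | nil => simp [edges]
  | cons e g h p ih =>
    obtain ⟨hu, hp⟩ := hp.of_cons
    exact List.nodup_cons.2 ⟨fun he => hu (p.mem_support_of_mem_edges he h), ih hp⟩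

theorem IsPath.gain_eq_zero {u : V} {p : Walk Φ u u} (hp : p.IsPath) : p.gain = 0 := by
  cases p with
  | nil => rfl
  | cons e g h p => exact absurd p.end_mem_support hp.of_cons.1

/-- A path can be split at any of its vertices. -/
theorem IsPath.exists_split {S : Finset E} {u v w : V} {p : Walk Φ u w} (hp : p.IsPath)
    (hS : p.InSet S) (hv : v ∈ p.support) :
    ∃ (q : Walk Φ u v) (r : Walk Φ v w), q.IsPath ∧ r.IsPath ∧ q.InSet S ∧ r.InSet S ∧
      (∀ x ∈ q.support, x ∈ p.support) ∧ p.gain = q.gain + r.gain := by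
  induction p with
  | nil x =>
    obtain rfl : v = x := by simpa [support] using hv
    exact ⟨nil v, nil v, hp, hp, hS, hS, fun _ h => h, by simp [gain]⟩
  | @cons a b c e g h p ih =>
    by_cases hva : v = a
    · subst hva
      exact ⟨nil v, cons e g h p, by simp [IsPath, support], hp, inSet_nil S v, hS,
        by simp [support], by simp [gain]⟩
    · obtain ⟨ha, hp'⟩ := hp.of_cons
      obtain ⟨he, hS'⟩ := inSet_cons.1 hS
      obtain ⟨q, r, hq, hr, hqS, hrS, hsub, hg⟩ := ih hp' hS'
        (by simpa [support, hva] using hv)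
      refine ⟨cons e g h q, r, List.nodup_cons.2 ⟨fun h' => ha (hsub _ h'), hq⟩, hr,
        inSet_cons.2 ⟨he, hqS⟩, hrS, ?_, by simp [gain, hg, add_assoc]⟩
      intro x hx
      simp only [support, List.mem_cons] at hx ⊢
      exact hx.imp_right (hsub x)

/-- In a balanced set, closing a path by an edge gives a closed walk of gain `0`. -/
theorem IsPath.gain_cons_eq_zero {S : Finset E} (hB : Φ.Balanced S) {u v : V} {e : E} {g : G}
    (h : Φ.Traverses e u v g) (he : e ∈ S) {q : Walk Φ v u} (hq : q.IsPath) (hS : q.InSet S) :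
    g + q.gain = 0 := by
  -- If `e` is not in `q`, closing up gives a circle. Otherwise, since `q` visits `v` only once, `e`
  -- is its first edge, run backwards, and the rest is a closed path, hence trivial.
  by_cases heq : e ∈ q.edges
  · cases q with
    | nil => simp [edges] at heq
    | cons e' g' h' q =>
      obtain ⟨hv, hq'⟩ := hq.of_cons
      rw [edges, List.mem_cons] at heq
      rcases heq with rfl | heq
      · rcases h.eq_or_eq h' with ⟨rfl, rfl, -⟩ | ⟨-, rfl, rfl⟩
        · exact absurd q.start_mem_support hv
        · simp [gain, hq'.gain_eq_zero]
      · exact absurd (q.mem_support_of_mem_edges heq h.symm) hv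
  · exact hB.2 u (cons e g h q)
      ⟨by simp [edges], List.nodup_cons.2 ⟨heq, hq.edges_nodup⟩, hq⟩ (inSet_cons.2 ⟨he, hS⟩)

/-- In a balanced set, every walk can be replaced by a path with the same ends and gain. -/
theorem exists_isPath_gain_eq {S : Finset E} (hB : Φ.Balanced S) {u v : V} (p : Walk Φ u v)
    (hS : p.InSet S) : ∃ q : Walk Φ u v, q.IsPath ∧ q.InSet S ∧ q.gain = p.gain := by
  induction p with
  | nil x => exact ⟨nil x, by simp [IsPath, support], hS, rfl⟩
  | @cons a b c e g h p ih =>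
    obtain ⟨he, hS'⟩ := inSet_cons.1 hS
    obtain ⟨q, hq, hqS, hg⟩ := ih hS'
    by_cases ha : a ∈ q.support
    -- The closed piece formed by `e` and `q₁` has gain `0` and can be cut off.
    · obtain ⟨q₁, q₂, hq₁, hq₂, hqS₁, hqS₂, -, hsum⟩ := hq.exists_split hqS ha
      refine ⟨q₂, hq₂, hqS₂, ?_⟩
      rw [gain, ← hg, hsum, ← add_assoc, hq₁.gain_cons_eq_zero hB h he hqS₁, zero_add]
    · exact ⟨cons e g h q, List.nodup_cons.2 ⟨ha, hq⟩, inSet_cons.2 ⟨he, hqS⟩,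
        by rw [gain, gain, hg]⟩

/-- Following `p` and then `q` backwards is a closed walk; the path it reduces to is trivial. -/
theorem gain_eq_of_balanced {S : Finset E} (hB : Φ.Balanced S) {u v : V} {p q : Walk Φ u v}
    (hp : p.InSet S) (hq : q.InSet S) : p.gain = q.gain := by
  obtain ⟨r, hr, -, hg⟩ := exists_isPath_gain_eq hB _ (hp.append hq.reverse)
  rw [hr.gain_eq_zero, gain_append, gain_reverse, ← sub_eq_add_neg] at hg
  exact sub_eq_zero.1 hg.symm

/-- The values of a potential differ along a walk by the gain of the walk. -/
theorem eq_gain_add {S : Finset E} {η : V → G}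
    (hη : ∀ e ∈ S, ∀ (u v : V) (g : G), Φ.Traverses e u v g → η u = g + η v)
    {u v : V} (p : Walk Φ u v) (hp : p.InSet S) : η u = p.gain + η v := by
  induction p with
  | nil => simp [gain]
  | cons e g h p ih =>
    obtain ⟨he, hp'⟩ := inSet_cons.1 hp
    rw [hη e he _ _ _ h, ih hp', gain, add_assoc]

end Walk

end Walks

/-! ### Components, potentials and existence of the top switching function. -/

section Components

variable {V E G : Type*} [AddCommGroup G] [Fintype V] {Φ : GainGraph V E G} {S : Finset E}

theorem mem_component {v w : V} : w ∈ Φ.component S v ↔ ∃ p : Walk Φ v w, p.InSet S := by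
  simp [component]

theorem self_mem_component (v : V) : v ∈ Φ.component S v :=
  mem_component.2 ⟨.nil v, Walk.inSet_nil S v⟩

theorem component_eq {v w : V} (h : w ∈ Φ.component S v) : Φ.component S w = Φ.component S v := by
  obtain ⟨p, hp⟩ := mem_component.1 h
  ext x
  rw [mem_component, mem_component]
  exact ⟨fun ⟨q, hq⟩ => ⟨p.append q, hp.append hq⟩,
    fun ⟨q, hq⟩ => ⟨p.reverse.append q, hp.reverse.append hq⟩⟩

theorem component_mem_parts (v : V) : Φ.component S v ∈ Φ.parts S := by
  classical
  exact Finset.mem_image_of_mem _ (Finset.mem_univ v)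

theorem mem_parts {W : Finset V} : W ∈ Φ.parts S ↔ ∃ v, Φ.component S v = W := by
  simp [parts]

theorem component_eq_of_mem_parts {W : Finset V} (hW : W ∈ Φ.parts S) {v : V} (hv : v ∈ W) :
    Φ.component S v = W := by
  obtain ⟨w, rfl⟩ := mem_parts.1 hW
  exact component_eq hv

theorem nonempty_of_mem_parts {W : Finset V} (hW : W ∈ Φ.parts S) : W.Nonempty := by
  obtain ⟨w, rfl⟩ := mem_parts.1 hW
  exact ⟨w, self_mem_component w⟩

theorem mem_component_of_traverses {e : E} (he : e ∈ S) {u v : V} {g : G}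
    (h : Φ.Traverses e u v g) : v ∈ Φ.component S u :=
  mem_component.2 ⟨.cons e g h (.nil v), Walk.inSet_cons.2 ⟨he, Walk.inSet_nil S v⟩⟩

/-- The potential at `v` is the gain of any walk from `v` to a root of its component; balance makes
the choice of walk irrelevant. -/
theorem exists_potential (hB : Φ.Balanced S) :
    ∃ θ : V → G, ∀ e ∈ S, ∀ (u v : V) (g : G), Φ.Traverses e u v g → θ u = g + θ v := by
  have hne : ∀ v, (Φ.component S v).Nonempty := fun v => ⟨v, self_mem_component v⟩
  -- The root depends on the component as a set only, so joined vertices share it.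
  let r : Finset V → Option V := fun W => W.toList.head?
  have hr : ∀ v, ∃ w, r (Φ.component S v) = some w ∧ w ∈ Φ.component S v := by
    intro v
    cases hl : (Φ.component S v).toList with
    | nil => exact absurd (Finset.toList_eq_nil.1 hl) (hne v).ne_empty
    | cons w l => exact ⟨w, by simp [r, hl], by rw [← Finset.mem_toList, hl]; simp⟩
  choose w hw hmem using hr
  choose p hp using fun v => mem_component.1 (hmem v)
  refine ⟨fun v => (p v).gain, fun e he u v g h => ?_⟩
  have hc := component_eq (mem_component_of_traverses he h)
  have hwv : w v = w u := by
    have := hw v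
    rw [hc, hw u] at this
    exact (Option.some_injective _ this).symm
  -- The endpoint is generalized because the type of `p v` depends on `w v`.
  have key : ∀ (x : V) (q : Walk Φ v x), q.InSet S → x = w u → (p u).gain = g + q.gain := by
    rintro x q hq rfl
    exact Walk.gain_eq_of_balanced hB (q := .cons e g h q) (hp u) (Walk.inSet_cons.2 ⟨he, hq⟩)
  exact key _ (p v) (hp v) hwv

/-- Subtracting from a potential its meet over each component keeps differences along edges and
makes the meet `0`. -/
theorem exists_isTopSwitching {d : ℕ} {Φ : GainGraph V E (Fin d → ℤ)} (hB : Φ.Balanced S) :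
    ∃ η, Φ.IsTopSwitching S η := by
  obtain ⟨θ, hθ⟩ := exists_potential hB
  have hne : ∀ v, (Φ.component S v).Nonempty := fun v => ⟨v, self_mem_component v⟩
  refine ⟨fun v => θ v - (Φ.component S v).inf' (hne v) θ, fun e he u v g h => ?_, ?_⟩
  · have hc := component_eq (mem_component_of_traverses he h)
    simp only [hθ e he u v g h, hc]
    abel
  · intro W hW
    constructor
    · rintro _ ⟨v, -, rfl⟩
      exact sub_nonneg.2 (Finset.inf'_le θ (self_mem_component v))
    · intro b hb
      obtain ⟨w, rfl⟩ := mem_parts.1 hW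
      have h1 : b + (Φ.component S w).inf' (hne w) θ ≤ (Φ.component S w).inf' (hne w) θ := by
        refine Finset.le_inf' _ _ fun v hv => ?_
        have := hb ⟨v, hv, rfl⟩
        simp only [component_eq hv] at this
        exact le_sub_iff_add_le.1 this
      calc b = b + (Φ.component S w).inf' (hne w) θ - (Φ.component S w).inf' (hne w) θ :=
            (add_sub_cancel_right _ _).symm
        _ ≤ _ := sub_le_sub_right h1 _
        _ = 0 := sub_self _

end Components

end GainGraph

/-! ### Top-degree forms of products of polynomials. -/

section LeadingForms

open MvPolynomial

variable {σ R : Type*} [CommSemiring R]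

theorem MvPolynomial.degree_le_totalDegree_of_coeff_ne_zero {p : MvPolynomial σ R} {m : σ →₀ ℕ}
    (h : coeff m p ≠ 0) : m.degree ≤ p.totalDegree :=
  le_totalDegree (mem_support_iff.2 h)

/-- Two degrees bounded by `a` and `b` can sum to `a + b` only if both bounds are attained. -/
theorem MvPolynomial.homogeneousComponent_mul_of_totalDegree_le {p q : MvPolynomial σ R} {a b : ℕ}
    (hp : p.totalDegree ≤ a) (hq : q.totalDegree ≤ b) :
    homogeneousComponent (a + b) (p * q) =
      homogeneousComponent a p * homogeneousComponent b q := by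
  classical
  ext m
  by_cases hm : m.degree = a + b
  · rw [coeff_homogeneousComponent, if_pos hm, coeff_mul, coeff_mul]
    refine Finset.sum_congr rfl fun ⟨i, j⟩ hij => ?_
    have hd : i.degree + j.degree = a + b := by
      rw [← hm, ← Finset.HasAntidiagonal.mem_antidiagonal.1 hij, map_add]
    simp only [coeff_homogeneousComponent]
    by_cases hi : coeff i p = 0
    · simp [hi]
    by_cases hj : coeff j q = 0
    · simp [hj]
    have h1 := (degree_le_totalDegree_of_coeff_ne_zero hi).trans hp
    have h2 := (degree_le_totalDegree_of_coeff_ne_zero hj).trans hq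
    rw [if_pos (by omega), if_pos (by omega)]
  · rw [coeff_homogeneousComponent, if_neg hm]
    refine (((homogeneousComponent_isHomogeneous a p).mul
      (homogeneousComponent_isHomogeneous b q)).coeff_eq_zero hm).symm

theorem MvPolynomial.totalDegree_prod_le_card_mul {ι : Type*} (s : Finset ι)
    {f : ι → MvPolynomial σ R} {a : ℕ} (hf : ∀ i ∈ s, (f i).totalDegree ≤ a) :
    (∏ i ∈ s, f i).totalDegree ≤ s.card * a :=
  (totalDegree_finsetProd s f).trans (Finset.sum_le_card_nsmul s _ a hf)

theorem MvPolynomial.homogeneousComponent_prod_of_totalDegree_le {ι : Type*} (s : Finset ι)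
    {f : ι → MvPolynomial σ R} {a : ℕ} (hf : ∀ i ∈ s, (f i).totalDegree ≤ a) :
    homogeneousComponent (s.card * a) (∏ i ∈ s, f i) =
      ∏ i ∈ s, homogeneousComponent a (f i) := by
  classical
  induction s using Finset.induction_on with
  | empty => simp
  | insert i s hi ih =>
    have hs : ∀ j ∈ s, (f j).totalDegree ≤ a := fun j hj => hf j (Finset.mem_insert_of_mem hj)
    rw [Finset.card_insert_of_notMem hi, Finset.prod_insert hi, Finset.prod_insert hi, ← ih hs,
      add_mul, one_mul, add_comm, homogeneousComponent_mul_of_totalDegree_le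
        (hf i (Finset.mem_insert_self i s)) (totalDegree_prod_le_card_mul s hs)]

end LeadingForms

/-! ### The polynomial factor contributed by one part. -/

section PartPolynomial

open MvPolynomial

variable {d : ℕ}

/-- The polynomial `∏_k (X_k - c_k) - N`. -/
noncomputable def boxPolynomial (c : Fin d → ℤ) (N : ℤ) : MvPolynomial (Fin d) ℤ :=
  (∏ k, (X k - C (c k))) - C N

theorem eval_boxPolynomial (c m : Fin d → ℤ) (N : ℤ) :
    eval m (boxPolynomial c N) = (∏ k, (m k - c k)) - N := by
  simp [boxPolynomial]

theorem totalDegree_X_sub_C_le (k : Fin d) (c : ℤ) :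
    (X k - C c : MvPolynomial (Fin d) ℤ).totalDegree ≤ 1 :=
  (totalDegree_sub_C_le _ _).trans (totalDegree_X k).le

theorem totalDegree_boxPolynomial_le (c : Fin d → ℤ) (N : ℤ) :
    (boxPolynomial c N).totalDegree ≤ d := by
  refine (totalDegree_sub_C_le _ _).trans ?_
  simpa using totalDegree_prod_le_card_mul Finset.univ
    fun k _ => totalDegree_X_sub_C_le k (c k)

theorem degreeOf_boxPolynomial_le (c : Fin d → ℤ) (N : ℤ) (k : Fin d) :
    (boxPolynomial c N).degreeOf k ≤ 1 := by
  refine (degreeOf_sub_le _ _ _).trans (max_le ?_ ((degreeOf_C N k).trans_le zero_le_one))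
  refine (degreeOf_prod_le _ _ _).trans ?_
  have h : ∀ j, degreeOf k (X j - C (c j) : MvPolynomial (Fin d) ℤ) ≤ if k = j then 1 else 0 := by
    intro j
    refine (degreeOf_sub_le _ _ _).trans ?_
    rw [degreeOf_C, degreeOf_X, max_eq_left (Nat.zero_le _)]
  exact (Finset.sum_le_sum fun j _ => h j).trans (by simp)

theorem homogeneousComponent_boxPolynomial (hd : 0 < d) (c : Fin d → ℤ) (N : ℤ) :
    homogeneousComponent d (boxPolynomial c N) = ∏ k, X k := by
  -- For `d = 0` the constant `N` would belong to the leading form.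
  have h1 : homogeneousComponent d (C N : MvPolynomial (Fin d) ℤ) = 0 :=
    homogeneousComponent_eq_zero _ _ ((totalDegree_C N).trans_lt hd)
  have h2 := homogeneousComponent_prod_of_totalDegree_le Finset.univ
    fun k _ => totalDegree_X_sub_C_le k (c k)
  simp only [Finset.card_univ, Fintype.card_fin, mul_one] at h2
  rw [boxPolynomial, map_sub, h1, sub_zero, h2]
  refine Finset.prod_congr rfl fun k _ => ?_
  rw [map_sub, homogeneousComponent_eq_zero 1 (C (c k)) ((totalDegree_C (c k)).trans_lt one_pos), sub_zero,
    homogeneousComponent_eq_self (isHomogeneous_X _ _)]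

end PartPolynomial

/-! ### Color lists: base point, finite gap set and its join. -/

section Lists

variable {d : ℕ}

theorem listBase_le {H : Set (Fin d → ℤ)} (hH : IsW2 H) {x : Fin d → ℤ} (hx : x ∈ H) :
    listBase H ≤ x :=
  csInf_le hH.1 hx

theorem infinite_Ici_pi_int (hd : 0 < d) (a : Fin d → ℤ) : (Set.Ici a).Infinite := by
  refine Set.infinite_of_injective_forall_mem (f := fun (n : ℕ) (k : Fin d) => a k + n) ?_ ?_
  · intro m n h
    have := congrFun h ⟨0, hd⟩
    simpa using this
  · intro n k
    simp

theorem listGaps_finite (hd : 0 < d) {H : Set (Fin d → ℤ)} (hH : IsW2 H) :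
    (listGaps H).Finite := by
  obtain ⟨-, a, A, hA, -, rfl⟩ := hH
  refine hA.subset ?_
  rintro x ⟨hx, hxH⟩
  by_contra hxA
  -- Nonemptiness makes `listBase` a genuine meet, hence at least `a`, so every gap lies in `A`.
  have hne : (Set.Ici a \ A).Nonempty := ((infinite_Ici_pi_int hd a).sdiff hA).nonempty
  have ha : a ≤ listBase (Set.Ici a \ A) := le_csInf hne fun y hy => hy.1
  exact hxH ⟨ha.trans hx, hxA⟩

theorem mem_list_iff {H : Set (Fin d → ℤ)} (hH : IsW2 H) {x : Fin d → ℤ} :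
    x ∈ H ↔ listBase H ≤ x ∧ x ∉ listGaps H :=
  ⟨fun hx => ⟨listBase_le hH hx, fun h => h.2 hx⟩, fun ⟨h1, h2⟩ => by
    by_contra hx
    exact h2 ⟨h1, hx⟩⟩

theorem le_listHat (hd : 0 < d) {H : Set (Fin d → ℤ)} (hH : IsW2 H) {x : Fin d → ℤ}
    (hx : x ∈ listGaps H) : x ≤ listHat H := by
  rw [listHat, if_neg (Set.nonempty_iff_ne_empty.1 ⟨x, hx⟩)]
  exact le_csSup (listGaps_finite hd hH).bddAbove hx

/-- Equality holds when there are no gaps. The bound gives side lengths `≥ 0`; a side `0` is an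
empty box, still counted correctly. -/
theorem listBase_le_listHat_add_one (hd : 0 < d) {H : Set (Fin d → ℤ)} (hH : IsW2 H) :
    listBase H ≤ listHat H + 1 := by
  by_cases h : listGaps H = ∅
  · rw [listHat, if_pos h, sub_add_cancel]
  · obtain ⟨x, hx⟩ := Set.nonempty_iff_ne_empty.2 h
    exact (Set.mem_Ici.1 hx.1).trans ((le_listHat hd hH hx).trans
      (le_add_of_nonneg_right zero_le_one))

end Lists

namespace GainGraph

/-! ### Path gains are bounded. -/

section PathGains

variable {V E : Type*} [Fintype V] [Finite E] {d : ℕ} {Φ : GainGraph V E (Fin d → ℤ)}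

theorem exists_traverses_le : ∃ M : Fin d → ℤ, 0 ≤ M ∧
    ∀ (e : E) (u v : V) (g : Fin d → ℤ), Φ.Traverses e u v g → g ≤ M := by
  have hfin : {g : Fin d → ℤ | ∃ e u v, Φ.Traverses e u v g}.Finite := by
    have h : ∀ p : E × V × V, {g | Φ.Traverses p.1 p.2.1 p.2.2 g}.Finite := by
      rintro ⟨e, u, v⟩
      by_cases hg : ∃ g, Φ.Traverses e u v g
      · obtain ⟨g, hg⟩ := hg
        refine (Set.toFinite {g, -g}).subset fun g' hg' => ?_
        rcases hg.eq_or_eq hg' with ⟨-, -, h⟩ | ⟨-, -, h⟩ <;> simp [h]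
      · push Not at hg
        exact Set.finite_empty.subset fun g' hg' => hg g' hg'
    refine (Set.finite_iUnion h).subset ?_
    rintro g ⟨e, u, v, h⟩
    exact Set.mem_iUnion.2 ⟨⟨e, u, v⟩, h⟩
  obtain ⟨M, hM⟩ := hfin.bddAbove
  exact ⟨M ⊔ 0, le_sup_right, fun e u v g h => le_sup_of_le_left (hM ⟨e, u, v, h⟩)⟩

/-- Boundedness makes the `sSup` in `pathGainSup` a true supremum. A path has at most `card V`
vertices, and each edge gain is at most a fixed `M ≥ 0`. -/
theorem bddAbove_pathGains (v : V) :
    BddAbove {g | ∃ (w : V) (p : Walk Φ v w), p.IsPath ∧ p.gain = g} := by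
  obtain ⟨M, hM0, hM⟩ := exists_traverses_le (Φ := Φ)
  have hwalk : ∀ {u w : V} (p : Walk Φ u w), p.gain ≤ p.support.length • M := by
    intro u w p
    induction p with
    | nil => simpa [Walk.gain, Walk.support] using hM0
    | cons e g h p ih =>
      rw [Walk.gain, Walk.support, List.length_cons, succ_nsmul']
      exact add_le_add (hM _ _ _ _ h) ih
  refine ⟨Fintype.card V • M, ?_⟩
  rintro _ ⟨w, p, hp, rfl⟩
  exact (hwalk p).trans (nsmul_le_nsmul_left hM0 (List.Nodup.length_le_card hp))

theorem Walk.gain_le_pathGainSup {v w : V} {p : Walk Φ v w} (hp : p.IsPath) :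
    p.gain ≤ Φ.pathGainSup v :=
  le_csSup (bddAbove_pathGains v) ⟨w, p, hp, rfl⟩

end PathGains

/-! ### Properties of the top switching function. -/

section TopSwitching

variable {V E : Type*} [Fintype V] {d : ℕ} {Φ : GainGraph V E (Fin d → ℤ)} {S : Finset E}

theorem isTopSwitching_topSwitching (hB : Φ.Balanced S) :
    Φ.IsTopSwitching S (Φ.topSwitching S) :=
  Classical.epsilon_spec (exists_isTopSwitching hB)

theorem topSwitching_eq (hB : Φ.Balanced S) (e : E) (he : e ∈ S) (u v : V) (g : Fin d → ℤ)
    (h : Φ.Traverses e u v g) : Φ.topSwitching S u = g + Φ.topSwitching S v := by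
  have := (isTopSwitching_topSwitching hB).1 e he u v g h
  rwa [add_assoc, neg_add_eq_zero] at this

theorem topSwitching_nonneg (hB : Φ.Balanced S) (v : V) : 0 ≤ Φ.topSwitching S v :=
  ((isTopSwitching_topSwitching hB).2 _ (component_mem_parts v)).1
    ⟨v, Finset.mem_coe.2 (self_mem_component v), rfl⟩

/-- The meet `0` is attained in each coordinate separately, at a vertex depending on `k`: otherwise,
values being integers, the `k`-th unit vector would be a lower bound. -/
theorem exists_topSwitching_apply_eq_zero (hB : Φ.Balanced S) {W : Finset V}
    (hW : W ∈ Φ.parts S) (k : Fin d) : ∃ j ∈ W, Φ.topSwitching S j k = 0 := by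
  by_contra! h
  have hlb : (Pi.single k 1 : Fin d → ℤ) ∈ lowerBounds (Φ.topSwitching S '' (W : Set V)) := by
    rintro _ ⟨j, hj, rfl⟩
    intro i
    have h0 : 0 ≤ Φ.topSwitching S j i := topSwitching_nonneg hB j i
    by_cases hi : i = k
    · subst hi
      rw [Pi.single_eq_same]
      exact h0.lt_of_ne' (h j hj)
    · rwa [Pi.single_eq_of_ne hi]
  have := ((isTopSwitching_topSwitching hB).2 W hW).2 hlb k
  simp at this

/-- In coordinate `k`, the value at `v` is the gain of a path from `v` to a vertex where that
coordinate vanishes. -/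
theorem topSwitching_le_pathGainSup [Finite E] (hB : Φ.Balanced S) (v : V) :
    Φ.topSwitching S v ≤ Φ.pathGainSup v := by
  intro k
  obtain ⟨j, hj, hj0⟩ := exists_topSwitching_apply_eq_zero hB (component_mem_parts v) k
  obtain ⟨p, hp⟩ := mem_component.1 hj
  obtain ⟨q, hq, hqS, -⟩ := p.exists_isPath_gain_eq hB hp
  rw [q.eq_gain_add (topSwitching_eq hB) hqS, Pi.add_apply, hj0, add_zero]
  exact Walk.gain_le_pathGainSup hq k

end TopSwitching

/-! ### The improper edges of a coloration form a closed balanced set. -/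

section Improper

variable {V E G : Type*} [AddCommGroup G] [Finite E]

/-- The edges that are not properly colored by `x`. -/
noncomputable def improperEdges (Φ : GainGraph V E G) (x : V → G) : Finset E :=
  (Set.toFinite {e | ∃ i j g, Φ.Traverses e i j g ∧ x j = x i + g}).toFinset

variable {Φ : GainGraph V E G} {x : V → G}

theorem mem_improperEdges {e : E} :
    e ∈ Φ.improperEdges x ↔ ∃ i j g, Φ.Traverses e i j g ∧ x j = x i + g := by
  simp [improperEdges]

theorem eq_of_mem_improperEdges {e : E} (he : e ∈ Φ.improperEdges x) {u v : V} {g : G}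
    (h : Φ.Traverses e u v g) : x v = x u + g := by
  obtain ⟨i, j, g', h', hx⟩ := mem_improperEdges.1 he
  rcases h.eq_or_eq h' with ⟨rfl, rfl, rfl⟩ | ⟨rfl, rfl, rfl⟩
  · exact hx
  · rw [hx, neg_add_cancel_right]

theorem Walk.end_eq_of_inSet_improperEdges {S : Finset E} (hS : S ⊆ Φ.improperEdges x) {u v : V}
    (p : Walk Φ u v) (hp : p.InSet S) : x v = x u + p.gain := by
  have := p.eq_gain_add (η := fun v => -x v) (fun e he u v g h => by
    rw [eq_of_mem_improperEdges (hS he) h]; abel) hp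
  rwa [← sub_eq_add_neg, eq_sub_iff_add_eq, neg_add_eq_iff_eq_add] at this

/-- A closed walk of improper edges returns to its starting color, and half edges have no traversal.
-/
theorem balanced_improperEdges (x : V → G) : Φ.Balanced (Φ.improperEdges x) := by
  refine ⟨fun e he v h => ?_, fun v p _ hp => ?_⟩
  · obtain ⟨i, j, g, h', -⟩ := mem_improperEdges.1 he
    cases h' with
    | fwd h' => rw [h] at h'; cases h'
    | bwd h' => rw [h] at h'; cases h'
  · exact left_eq_add.1 (p.end_eq_of_inSet_improperEdges subset_rfl hp)

theorem closed_improperEdges (hloose : ∀ e : E, Φ.kind e ≠ EdgeKind.loose) (x : V → G) :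
    Φ.Closed (Φ.improperEdges x) := by
  refine ⟨?_, fun e he => absurd he (hloose e)⟩
  rintro e u v g h ⟨p, -, hp, rfl⟩
  exact mem_improperEdges.2 ⟨u, v, _, h, p.end_eq_of_inSet_improperEdges subset_rfl hp⟩

end Improper

/-! ### Möbius inversion on the closed balanced sets. -/

section Mobius

variable {V E G : Type*} [AddCommGroup G] {Φ : GainGraph V E G}

theorem balanced_empty : Φ.Balanced ∅ := by
  refine ⟨by simp, fun v p hc hp => absurd ?_ hc.1⟩
  exact List.eq_nil_iff_forall_not_mem.2 fun e he => absurd (hp e he) (Finset.notMem_empty e)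

/-- Paths without edges are trivial, so only balanced loops or loose edges could be forced in. This
selects the genuine Möbius branch of `muEmpty`. -/
theorem closed_empty (hloop : ∀ (e : E) (v : V), ¬ Φ.Traverses e v v 0)
    (hloose : ∀ e : E, Φ.kind e ≠ EdgeKind.loose) : Φ.Closed ∅ := by
  refine ⟨?_, fun e he => absurd he (hloose e)⟩
  rintro e u v g h ⟨p, -, hp, rfl⟩
  cases p with
  | nil => exact absurd h (hloop e u)
  | cons e' g h' p => exact absurd (hp e' (by simp [Walk.edges])) (Finset.notMem_empty e')

theorem muEmpty_empty [Finite E] (h : Φ.Balanced ∅ ∧ Φ.Closed ∅) :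
    Φ.muEmpty ⟨∅, h⟩ = 1 := by
  classical
  let : LocallyFiniteOrder Φ.LatB := Fintype.toLocallyFiniteOrder
  rw [muEmpty, dif_pos h]
  exact IncidenceAlgebra.mu_self _

-- This is the defining identity of `μ` on the interval from `∅` to `I`, later used with `I` the
-- improper edges of a coloration.
open Classical in
theorem sum_muEmpty_subset [Finite E] (h : Φ.Balanced ∅ ∧ Φ.Closed ∅) (I : Φ.LatB) :
    ∑ B : Φ.LatB, Φ.muEmpty B * (if B.1 ⊆ I.1 then 1 else 0) = if I.1 = ∅ then 1 else 0 := by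
  let : LocallyFiniteOrder Φ.LatB := Fintype.toLocallyFiniteOrder
  have hs := IncidenceAlgebra.sum_Icc_mu_right (𝕜 := ℤ) (⟨∅, h⟩ : Φ.LatB) I
  have hI : (⟨∅, h⟩ : Φ.LatB) = I ↔ I.1 = ∅ := by rw [Subtype.ext_iff, eq_comm]
  simp only [hI] at hs
  rw [← hs]
  simp only [mul_ite, mul_one, mul_zero]
  rw [← Finset.sum_filter]
  refine Finset.sum_congr ?_ fun B _ => by rw [muEmpty, dif_pos h]
  ext B
  simp only [Finset.mem_filter, Finset.mem_univ, true_and, Finset.mem_Icc]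
  exact ⟨fun hB => ⟨Finset.empty_subset _, hB⟩, fun hB => hB.2⟩

end Mobius

end GainGraph

namespace GainGraph

/-! ### List colorations, proper or not. -/

section ListColorations

variable {V E : Type*} {d : ℕ} {Φ : GainGraph V E (Fin d → ℤ)} {H : V → Set (Fin d → ℤ)}

theorem exists_traverses_of_mem {B : Finset E}
    (hloose : ∀ e : E, Φ.kind e ≠ EdgeKind.loose)
    (hB : Φ.Balanced B) {e : E} (he : e ∈ B) : ∃ u v g, Φ.Traverses e u v g := by
  cases h : Φ.kind e with
  | ordinary u v g => exact ⟨u, v, g, .fwd h⟩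
  | half v => exact absurd h (hB.1 e he v)
  | loose => exact absurd h (hloose e)

/-- The colorations by members of the lists with upper bounds `m`. -/
def listColorations (H : V → Set (Fin d → ℤ)) (m : V → Fin d → ℤ) : Set (V → Fin d → ℤ) :=
  {x | (∀ i, x i ∈ H i) ∧ x ≤ m}

theorem listColorations_finite [Finite V] (hH : ∀ i, IsW2 (H i)) (m : V → Fin d → ℤ) :
    (listColorations H m).Finite := by
  classical
  have := Fintype.ofFinite V
  refine (Set.finite_Icc (fun i => listBase (H i)) m).subset ?_
  rintro x ⟨hx, hxm⟩
  exact ⟨fun i => listBase_le (hH i) (hx i), hxm⟩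

theorem properColorations_eq [Finite E] (m : V → Fin d → ℤ) :
    Φ.properColorations H m = {x | x ∈ listColorations H m ∧ Φ.improperEdges x = ∅} := by
  ext x
  simp only [properColorations, listColorations, Set.mem_ofPred_eq, and_assoc]
  refine and_congr_right fun _ => and_congr_right fun _ => ?_
  rw [Finset.eq_empty_iff_forall_notMem]
  constructor
  · intro h e he
    obtain ⟨i, j, g, ht, hx⟩ := mem_improperEdges.1 he
    exact h e i j g ht hx
  · exact fun h e i j g ht hx => h e (mem_improperEdges.2 ⟨i, j, g, ht, hx⟩)

end ListColorations

/-! ### Counting the colorations for which all edges of `B` are improper. -/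

section Counting

variable {V E : Type*} [Fintype V] {d : ℕ} (Φ : GainGraph V E (Fin d → ℤ))
  (H : V → Set (Fin d → ℤ)) (B : Finset E)

/-- The base point of the contracted list of `W`. -/
noncomputable def partBase (W : Finset V) (k : Fin d) : ℤ :=
  sSup ((fun p : V × V =>
      listBase (H p.1) k + Φ.topSwitching B p.1 k - Φ.topSwitching B p.2 k) ''
    ((W : Set V) ×ˢ (W : Set V)))

theorem qBar_eq (W : Finset V) (m : Fin d → ℤ) (k : Fin d) :
    Φ.qBar H B W m k = m k - (Φ.partBase H B W k - 1) := by
  rw [qBar, partBase]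
  ring

variable {Φ H B}

/-- The maximum over pairs is reached where `η_B(j)_k = 0`, so it is the `k`-th coordinate of the
join of the `h_i + η_B(i)`. -/
theorem partBase_apply_le_iff (hB : Φ.Balanced B) {W : Finset V} (hW : W ∈ Φ.parts B)
    (k : Fin d) (t : ℤ) :
    Φ.partBase H B W k ≤ t ↔ ∀ i ∈ W, listBase (H i) k + Φ.topSwitching B i k ≤ t := by
  have hfin : ((fun p : V × V =>
      listBase (H p.1) k + Φ.topSwitching B p.1 k - Φ.topSwitching B p.2 k) ''
    ((W : Set V) ×ˢ (W : Set V))).Finite := (W.finite_toSet.prod W.finite_toSet).image _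
  constructor
  · intro h i hi
    obtain ⟨j, hj, hj0⟩ := exists_topSwitching_apply_eq_zero hB hW k
    refine (le_csSup hfin.bddAbove ⟨(i, j), ⟨hi, hj⟩, ?_⟩).trans h
    simp [hj0]
  · intro h
    obtain ⟨i, hi⟩ := nonempty_of_mem_parts hW
    refine csSup_le ⟨_, (i, i), ⟨hi, hi⟩, rfl⟩ ?_
    rintro _ ⟨⟨i, j⟩, ⟨hi, hj⟩, rfl⟩
    exact (sub_le_self _ (topSwitching_nonneg hB j k)).trans (h i hi)

theorem partBase_le_iff (hB : Φ.Balanced B) {W : Finset V} (hW : W ∈ Φ.parts B)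
    (y : Fin d → ℤ) :
    Φ.partBase H B W ≤ y ↔ ∀ i ∈ W, listBase (H i) + Φ.topSwitching B i ≤ y :=
  ⟨fun h i hi k => (partBase_apply_le_iff hB hW k _).1 (h k) i hi,
    fun h k => (partBase_apply_le_iff hB hW k _).2 fun i hi => h i hi k⟩

theorem mem_gapsOn {W : Finset V} {y : Fin d → ℤ} :
    y ∈ Φ.gapsOn H B W ↔ (∃ i ∈ W, y - Φ.topSwitching B i ∈ listGaps (H i)) ∧
      ∀ i ∈ W, listBase (H i) + Φ.topSwitching B i ≤ y := by
  simp only [gapsOn, Set.mem_inter_iff, Set.mem_iUnion, Set.mem_image, Set.mem_ofPred_eq,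
    exists_prop]
  refine and_congr_left fun _ => exists_congr fun i => and_congr_right fun _ => ?_
  constructor
  · rintro ⟨x, hx, rfl⟩
    rwa [add_sub_cancel_right]
  · exact fun h => ⟨_, h, sub_add_cancel _ _⟩

/-- A translated gap is at most `ĥ_i + η_B(i) ≤ ĥ_i + α_i`; this is what the lower bound on `m` is
made for. -/
theorem gapsOn_subset_Icc [Finite E] (hd : 0 < d) (hH : ∀ i, IsW2 (H i)) (hB : Φ.Balanced B)
    {m : Fin d → ℤ} (hm : ∀ j, listHat (H j) + Φ.pathGainSup j ≤ m) {W : Finset V}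
    (hW : W ∈ Φ.parts B) :
    Φ.gapsOn H B W ⊆ Set.Icc (Φ.partBase H B W) m := by
  intro y hy
  obtain ⟨⟨i, -, hi⟩, hbase⟩ := mem_gapsOn.1 hy
  refine ⟨(partBase_le_iff hB hW y).2 hbase, ?_⟩
  calc y = (y - Φ.topSwitching B i) + Φ.topSwitching B i := (sub_add_cancel _ _).symm
    _ ≤ listHat (H i) + Φ.pathGainSup i :=
      add_le_add (le_listHat hd (hH i) hi) (topSwitching_le_pathGainSup hB i)
    _ ≤ m := hm i

theorem qBar_nonneg [Finite E] (hd : 0 < d) (hH : ∀ i, IsW2 (H i)) (hB : Φ.Balanced B)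
    {m : Fin d → ℤ} (hm : ∀ j, listHat (H j) + Φ.pathGainSup j ≤ m) {W : Finset V}
    (hW : W ∈ Φ.parts B) (k : Fin d) : 0 ≤ Φ.qBar H B W m k := by
  have h : Φ.partBase H B W k ≤ m k + 1 := by
    refine (partBase_apply_le_iff hB hW k _).2 fun i _ => ?_
    have h1 := listBase_le_listHat_add_one hd (hH i) k
    have h2 := topSwitching_le_pathGainSup hB i k
    have h3 := hm i k
    simp only [Pi.add_apply, Pi.one_apply] at h1 h3
    linarith
  rw [qBar_eq]
  linarith

theorem card_Icc_sdiff_gapsOn [Finite E] (hd : 0 < d) (hH : ∀ i, IsW2 (H i)) (hB : Φ.Balanced B)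
    {m : Fin d → ℤ} (hm : ∀ j, listHat (H j) + Φ.pathGainSup j ≤ m) {W : Finset V}
    (hW : W ∈ Φ.parts B) :
    (((Finset.Icc (Φ.partBase H B W) m : Set (Fin d → ℤ)) \ Φ.gapsOn H B W).ncard : ℤ) =
      (∏ k, Φ.qBar H B W m k) - ((Φ.gapsOn H B W).ncard : ℤ) := by
  have hsub : Φ.gapsOn H B W ⊆ (Finset.Icc (Φ.partBase H B W) m : Set (Fin d → ℤ)) := by
    rw [Finset.coe_Icc]
    exact gapsOn_subset_Icc hd hH hB hm hW
  have h := Set.ncard_sdiff_add_ncard_of_subset hsub (Finset.finite_toSet _)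
  rw [Set.ncard_coe_finset, Pi.card_Icc] at h
  rw [eq_sub_iff_add_eq]
  have h' := congrArg (Nat.cast : ℕ → ℤ) h
  push_cast at h'
  rw [← Finset.coe_Icc] at h'
  push_cast
  rw [← Finset.coe_Icc]
  rw [h']
  refine Finset.prod_congr rfl fun k _ => ?_
  -- Interval cardinalities are truncated at `0`; nonnegativity makes them equal to `qBar`.
  have hk := qBar_nonneg hd hH hB hm hW k
  rw [Int.card_Icc, Int.toNat_of_nonneg] <;> rw [qBar_eq] at * <;> linarith

/-- The coloration that is `y W - η` on each part `W`. -/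
noncomputable def spread (Φ : GainGraph V E (Fin d → ℤ)) (B : Finset E)
    (y : Φ.parts B → Fin d → ℤ) (i : V) : Fin d → ℤ :=
  y ⟨Φ.component B i, component_mem_parts i⟩ - Φ.topSwitching B i

theorem spread_injective : Function.Injective (Φ.spread B) := by
  intro y z h
  funext ⟨W, hW⟩
  obtain ⟨i, rfl⟩ := mem_parts.1 hW
  exact sub_left_injective (congrFun h i)

variable [Finite E]

theorem spread_mem (hH : ∀ i, IsW2 (H i)) (hloose : ∀ e : E, Φ.kind e ≠ EdgeKind.loose)
    (hB : Φ.Balanced B) {m : Fin d → ℤ} {y : Φ.parts B → Fin d → ℤ}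
    (hy : ∀ W : Φ.parts B, y W ∈ Set.Icc (Φ.partBase H B W.1) m \ Φ.gapsOn H B W.1) :
    Φ.spread B y ∈ listColorations H (fun _ => m) ∧ B ⊆ Φ.improperEdges (Φ.spread B y) := by
  refine ⟨⟨fun i => ?_, fun i => ?_⟩, fun e he => ?_⟩
  · obtain ⟨⟨hb, -⟩, hg⟩ := hy ⟨Φ.component B i, component_mem_parts i⟩
    have hbase := (partBase_le_iff hB (component_mem_parts i) _).1 hb
    refine (mem_list_iff (hH i)).2 ⟨le_sub_iff_add_le.2 (hbase i (self_mem_component i)), ?_⟩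
    exact fun h => hg (mem_gapsOn.2 ⟨⟨i, self_mem_component i, h⟩, hbase⟩)
  · exact (sub_le_self _ (topSwitching_nonneg hB i)).trans (hy _).1.2
  · obtain ⟨u, v, g, h⟩ := exists_traverses_of_mem hloose hB he
    refine mem_improperEdges.2 ⟨u, v, g, h, ?_⟩
    have hc := component_eq (mem_component_of_traverses he h)
    simp only [spread, hc, topSwitching_eq hB e he u v g h]
    abel

/-- Along a walk in `B`, `x` gains exactly what `η_B` loses, so `x + η_B` is constant on each part.
-/
theorem exists_spread_eq (hH : ∀ i, IsW2 (H i)) (hB : Φ.Balanced B) {m : Fin d → ℤ}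
    {x : V → Fin d → ℤ} (hx : x ∈ listColorations H (fun _ => m))
    (hxB : B ⊆ Φ.improperEdges x) :
    ∃ y : Φ.parts B → Fin d → ℤ,
      (∀ W : Φ.parts B, y W ∈ Set.Icc (Φ.partBase H B W.1) m \ Φ.gapsOn H B W.1) ∧ Φ.spread B y = x := by
  choose r hr using fun W : Φ.parts B => nonempty_of_mem_parts W.2
  have hconst : ∀ (W : Φ.parts B) (i : V), i ∈ W.1 →
      x (r W) + Φ.topSwitching B (r W) = x i + Φ.topSwitching B i := by
    intro W i hi
    have hi' : i ∈ Φ.component B (r W) := by rwa [component_eq_of_mem_parts W.2 (hr W)]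
    obtain ⟨p, hp⟩ := mem_component.1 hi'
    rw [p.end_eq_of_inSet_improperEdges hxB hp, p.eq_gain_add (topSwitching_eq hB) hp, add_assoc]
  refine ⟨fun W => x (r W) + Φ.topSwitching B (r W), fun W : Φ.parts B => ⟨⟨?_, fun k => ?_⟩, fun hg => ?_⟩,
    funext fun i => ?_⟩
  · refine (partBase_le_iff hB W.2 _).2 fun i hi => ?_
    refine le_of_le_of_eq ?_ (hconst W i hi).symm
    exact add_le_add_left (listBase_le (hH i) (hx.1 i)) _
  -- The upper bound in coordinate `k` is read off at a vertex where `η_B` vanishes there. It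
  -- depends on all vertices having the same bound `m`.
  · obtain ⟨j, hj, hj0⟩ := exists_topSwitching_apply_eq_zero hB W.2 k
    refine le_of_eq_of_le (congrFun (hconst W j hj) k) ?_
    rw [Pi.add_apply, hj0, add_zero]
    exact hx.2 j k
  · obtain ⟨⟨i, hi, hgi⟩, -⟩ := mem_gapsOn.1 hg
    simp only [hconst W i hi, add_sub_cancel_right] at hgi
    exact hgi.2 (hx.1 i)
  · rw [spread, hconst _ i (self_mem_component i), add_sub_cancel_right]

theorem ncard_listColorations_improper (hd : 0 < d) (hH : ∀ i, IsW2 (H i))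
    (hloose : ∀ e : E, Φ.kind e ≠ EdgeKind.loose) (hB : Φ.Balanced B) {m : Fin d → ℤ}
    (hm : ∀ j, listHat (H j) + Φ.pathGainSup j ≤ m) :
    (({x | x ∈ listColorations H (fun _ => m) ∧ B ⊆ Φ.improperEdges x} :
      Set (V → Fin d → ℤ)).ncard : ℤ) =
    ∏ W ∈ Φ.parts B, ((∏ k, Φ.qBar H B W m k) - ((Φ.gapsOn H B W).ncard : ℤ)) := by
  classical
  let Y : Φ.parts B → Finset (Fin d → ℤ) := fun W =>
    (Finset.Icc (Φ.partBase H B W) m).filter fun y => y ∉ Φ.gapsOn H B W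
  have hY : ∀ W y, y ∈ Y W ↔ y ∈ Set.Icc (Φ.partBase H B W) m \ Φ.gapsOn H B W := by
    intro W y
    rw [Finset.mem_filter, Finset.mem_Icc]
    rfl
  have himage : ({x | x ∈ listColorations H (fun _ => m) ∧ B ⊆ Φ.improperEdges x} :
      Set (V → Fin d → ℤ)) = Φ.spread B '' (Fintype.piFinset Y : Set _) := by
    ext x
    simp only [Set.mem_ofPred_eq, Set.mem_image, Finset.mem_coe, Fintype.mem_piFinset, hY]
    constructor
    · exact fun ⟨h1, h2⟩ => exists_spread_eq hH hB h1 h2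
    · rintro ⟨y, hy, rfl⟩
      exact spread_mem hH hloose hB hy
  rw [himage, Set.ncard_image_of_injective _ spread_injective, Set.ncard_coe_finset,
    Fintype.card_piFinset, Nat.cast_prod, ← Finset.prod_coe_sort (Φ.parts B)]
  refine Finset.prod_congr rfl fun W _ => ?_
  rw [← card_Icc_sdiff_gapsOn hd hH hB hm W.2, ← Set.ncard_coe_finset]
  congr 2
  ext y
  rw [Finset.mem_coe, hY, Finset.coe_Icc]

theorem chi_eq_pBar (hd : 0 < d) (hloop : ∀ (e : E) (v : V), ¬ Φ.Traverses e v v 0)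
    (hloose : ∀ e : E, Φ.kind e ≠ EdgeKind.loose) (hH : ∀ i, IsW2 (H i)) {m : Fin d → ℤ}
    (hm : ∀ j, listHat (H j) + Φ.pathGainSup j ≤ m) :
    ((Φ.chi H fun _ => m : ℕ) : ℤ) = Φ.pBar H m := by
  classical
  have hfin := listColorations_finite hH fun _ => m
  have h0 : Φ.Balanced ∅ ∧ Φ.Closed ∅ := ⟨balanced_empty, closed_empty hloop hloose⟩
  have hcount : ∀ P : (V → Fin d → ℤ) → Prop,
      (({x | x ∈ listColorations H (fun _ => m) ∧ P x} : Set (V → Fin d → ℤ)).ncard : ℤ) =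
        ∑ x ∈ hfin.toFinset, if P x then 1 else 0 := by
    intro P
    rw [Finset.sum_boole, ← Set.ncard_coe_finset]
    simp
  rw [chi, properColorations_eq, hcount, pBar]
  simp_rw [← ncard_listColorations_improper hd hH hloose (Subtype.prop (p := fun S =>
    Φ.Balanced S ∧ Φ.Closed S) _).1 hm, hcount, Finset.mul_sum]
  -- With the coloration outermost, the inner sum over `B` is the Möbius indicator.
  rw [Finset.sum_comm]
  refine Finset.sum_congr rfl fun x _ => ?_
  convert (sum_muEmpty_subset h0
    ⟨Φ.improperEdges x, balanced_improperEdges x, closed_improperEdges hloose x⟩).symm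

end Counting

/-! ### Degree and leading form of `p̄`. -/

section Polynomial

variable {V E : Type*} [Fintype V] {d : ℕ} {Φ : GainGraph V E (Fin d → ℤ)}

theorem parts_empty : Φ.parts ∅ = Finset.univ.map ⟨singleton, Finset.singleton_injective⟩ := by
  classical
  have hc : ∀ v, Φ.component ∅ v = {v} := by
    intro v
    ext w
    rw [mem_component, Finset.mem_singleton]
    constructor
    · rintro ⟨p, hp⟩
      cases p with
      | nil => rfl
      | cons e g h p => exact absurd (Walk.inSet_cons.1 hp).1 (Finset.notMem_empty e)
    · rintro rfl
      exact ⟨.nil w, Walk.inSet_nil _ w⟩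
  ext W
  simp [mem_parts, hc]

theorem card_parts_empty : (Φ.parts ∅).card = Fintype.card V := by
  rw [parts_empty, Finset.card_map, Finset.card_univ]

theorem card_parts_le (B : Finset E) : (Φ.parts B).card ≤ Fintype.card V := by
  classical
  exact Finset.card_image_le

/-- An edge of `B` cannot be a loop, which would have gain `0` by balance; so it merges two vertices
into one part. -/
theorem card_parts_lt (hloop : ∀ (e : E) (v : V), ¬ Φ.Traverses e v v 0)
    (hloose : ∀ e : E, Φ.kind e ≠ EdgeKind.loose) {B : Finset E} (hB : Φ.Balanced B)
    (hne : B ≠ ∅) : (Φ.parts B).card < Fintype.card V := by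
  classical
  obtain ⟨e, he⟩ := Finset.nonempty_iff_ne_empty.2 hne
  obtain ⟨u, v, g, h⟩ := exists_traverses_of_mem hloose hB he
  have huv : u ≠ v := by
    rintro rfl
    have hg : g = 0 := by
      simpa [Walk.gain] using Walk.gain_eq_of_balanced hB
        (p := .cons e g h (.nil u)) (q := .nil u)
        (Walk.inSet_cons.2 ⟨he, Walk.inSet_nil _ _⟩) (Walk.inSet_nil _ _)
    exact hloop e u (hg ▸ h)
  refine lt_of_le_of_ne (card_parts_le B) fun hcard => huv ?_
  have hinj : Set.InjOn (Φ.component B) (Finset.univ : Finset V) :=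
    Finset.card_image_iff.1 (by rw [Finset.card_univ, ← hcard, parts])
  exact hinj (by simp) (by simp) (component_eq (mem_component_of_traverses he h)).symm

open MvPolynomial

variable [Finite E]

/-- The polynomial whose values are `pBar`. -/
noncomputable def pBarPolynomial (Φ : GainGraph V E (Fin d → ℤ)) (H : V → Set (Fin d → ℤ)) :
    MvPolynomial (Fin d) ℤ :=
  ∑ B : Φ.LatB, C (Φ.muEmpty B) * ∏ W ∈ Φ.parts B.1,
    boxPolynomial (fun k => Φ.partBase H B.1 W k - 1) ((Φ.gapsOn H B.1 W).ncard : ℤ)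

variable (H : V → Set (Fin d → ℤ))

theorem eval_pBarPolynomial (m : Fin d → ℤ) : eval m (Φ.pBarPolynomial H) = Φ.pBar H m := by
  simp only [pBarPolynomial, pBar, map_sum, map_mul, map_prod, eval_C, eval_boxPolynomial,
    qBar_eq]

theorem degreeOf_pBarPolynomial_le (k : Fin d) :
    (Φ.pBarPolynomial H).degreeOf k ≤ Fintype.card V := by
  refine (degreeOf_sum_le _ _ _).trans (Finset.sup_le fun B _ => ?_)
  refine (degreeOf_C_mul_le _ _ _).trans ((degreeOf_prod_le _ _ _).trans ?_)
  refine (Finset.sum_le_card_nsmul _ _ 1 fun W _ => degreeOf_boxPolynomial_le _ _ k).trans ?_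
  simpa using card_parts_le B.1

theorem totalDegree_term_le (H : V → Set (Fin d → ℤ)) (B : Φ.LatB) :
    (C (Φ.muEmpty B) * ∏ W ∈ Φ.parts B.1, boxPolynomial (fun k => Φ.partBase H B.1 W k - 1)
      ((Φ.gapsOn H B.1 W).ncard : ℤ)).totalDegree ≤ (Φ.parts B.1).card * d := by
  refine (totalDegree_mul _ _).trans ?_
  rw [totalDegree_C, zero_add]
  exact totalDegree_prod_le_card_mul _ fun W _ => totalDegree_boxPolynomial_le _ _

theorem homogeneousComponent_pBarPolynomial (hd : 0 < d)
    (hloop : ∀ (e : E) (v : V), ¬ Φ.Traverses e v v 0)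
    (hloose : ∀ e : E, Φ.kind e ≠ EdgeKind.loose) :
    homogeneousComponent (Fintype.card V * d) (Φ.pBarPolynomial H) =
      ∏ k : Fin d, (X k : MvPolynomial (Fin d) ℤ) ^ Fintype.card V := by
  have h0 : Φ.Balanced ∅ ∧ Φ.Closed ∅ := ⟨balanced_empty, closed_empty hloop hloose⟩
  rw [pBarPolynomial, map_sum, Finset.sum_eq_single (⟨∅, h0⟩ : Φ.LatB)]
  · rw [muEmpty_empty, C_1, one_mul, ← card_parts_empty (Φ := Φ),
      homogeneousComponent_prod_of_totalDegree_le _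
        fun W _ => totalDegree_boxPolynomial_le _ _]
    simp only [homogeneousComponent_boxPolynomial hd]
    rw [Finset.prod_const, Finset.prod_pow]
  · intro B _ hB
    refine homogeneousComponent_eq_zero _ _ ((totalDegree_term_le H B).trans_lt ?_)
    exact Nat.mul_lt_mul_of_pos_right
      (card_parts_lt hloop hloose B.2.1 fun h => hB (Subtype.ext h)) hd
  · exact fun h => absurd (Finset.mem_univ _) h

theorem totalDegree_pBarPolynomial (hd : 0 < d)
    (hloop : ∀ (e : E) (v : V), ¬ Φ.Traverses e v v 0)
    (hloose : ∀ e : E, Φ.kind e ≠ EdgeKind.loose) :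
    (Φ.pBarPolynomial H).totalDegree = Fintype.card V * d := by
  refine le_antisymm (totalDegree_finsetSum_le fun B _ => (totalDegree_term_le H B).trans
    (Nat.mul_le_mul_right d (card_parts_le B.1))) ?_
  -- A smaller total degree would annihilate the component in degree `n * d`, which is a nonzero
  -- monomial.
  by_contra! hlt
  have h := homogeneousComponent_pBarPolynomial H hd hloop hloose
  rw [homogeneousComponent_eq_zero _ _ hlt] at h
  exact Finset.prod_ne_zero_iff.2 (fun k _ => pow_ne_zero _ (X_ne_zero k)) h.symm

end Polynomial

end GainGraph

theorem corollaryC {V E : Type*} [Fintype V] [Finite E] {d : ℕ} (hd : 0 < d)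
    (Φ : GainGraph V E (Fin d → ℤ))
    (hloop : ∀ (e : E) (v : V), ¬ Φ.Traverses e v v 0)
    (hloose : ∀ e : E, Φ.kind e ≠ EdgeKind.loose)
    (H : V → Set (Fin d → ℤ)) (hH : ∀ i, IsW2 (H i)) :
    (∃ P : MvPolynomial (Fin d) ℤ,
      (∀ m' : Fin d → ℤ, MvPolynomial.eval m' P = Φ.pBar H m') ∧
      (∀ k, P.degreeOf k ≤ Fintype.card V) ∧
      P.homogeneousComponent P.totalDegree =
        ∏ k : Fin d, (MvPolynomial.X k : MvPolynomial (Fin d) ℤ) ^ Fintype.card V) ∧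
    ∀ m' : Fin d → ℤ, (∀ j, listHat (H j) + Φ.pathGainSup j ≤ m') →
      (Φ.properColorations H fun _ => m').Finite ∧
      ((Φ.chi H fun _ => m' : ℕ) : ℤ) = Φ.pBar H m' := by
  refine ⟨⟨Φ.pBarPolynomial H, Φ.eval_pBarPolynomial H, Φ.degreeOf_pBarPolynomial_le H, ?_⟩,
    fun m' hm => ⟨?_, GainGraph.chi_eq_pBar hd hloop hloose hH hm⟩⟩
  · rw [GainGraph.totalDegree_pBarPolynomial H hd hloop hloose]
    exact GainGraph.homogeneousComponent_pBarPolynomial H hd hloop hloose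
  -- Finiteness is a separate claim, as `ncard` is `0` on infinite sets.
  · exact (GainGraph.listColorations_finite hH fun _ => m').subset
      fun x hx => ⟨hx.1, hx.2.1⟩
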